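/- Let $Q:\mathbb{R}\to\mathbb{R}$ be locally integrable, let $V\in L^1(\mathbb{R})$ be real-valued with $\operatorname{supp} V\subseteq[0,1]$, and let $u_0:\mathbb{R}\to\mathbb{C}$ be a solution of $-u_0''+Qu_0=0$ that is not identically zero. (A solution is a differentiable function whose derivative is locally absolutely continuous and which satisfies the equation almost everywhere.) For $\lambda\in\mathbb{C}$ let $u_\lambda$ be the solution of $-u_\lambda''+Qu_\lambda+\lambda Vu_\lambda=0$ on $\mathbb{R}$ with $u_\lambda(x)=u_0(x)$ for all $x<0$, and let $$b(\lambda)=u_0'(x)\,u_\lambda(x)-u_0(x)\,u_\lambda'(x)\qquad\text{for any }x>1,$$ which does not depend on the choice of $x>1$. Suppose that $V\not\equiv0$, i.e. $V$ is not zero almost everywhere. Then $b$ is an entire function of $\lambda$ that is not identically zero, and it is of order at most $1/2$ and finite type in the sense that there are constants $C,c>0$ with $|b(\lambda)|\le C\exp(c|\lambda|^{1/2})$ for all $\lambda\in\mathbb{C}$. Moreover, for every $r$ the number of zeros of $b$ in the disk $|\lambda|\le r$, counted with multiplicity, is finite, and it is $O(r^{1/2})$ as $r\to\infty$. -/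

import Mathlib

open MeasureTheory

/-- `u` is a (Carathéodory) solution on the whole line of `-u'' + q u = 0`, for a locally integrable
potential `q`: `u` is differentiable, `u'` is locally absolutely continuous, and the equation holds
almost everywhere. -/
structure IsSchrodingerSolution (q : ℝ → ℂ) (u : ℝ → ℂ) : Prop where
  differentiable : Differentiable ℝ u
  deriv_absolutelyContinuous : ∀ a b : ℝ, AbsolutelyContinuousOnInterval (deriv u) a b
  equation : ∀ᵐ x : ℝ, -deriv (deriv u) x + q x * u x = 0

/-- The Wronskian `W[u, v](x) = u'(x) v(x) - u(x) v'(x)`. -/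
noncomputable def schrodingerWronskian (u v : ℝ → ℂ) (x : ℝ) : ℂ :=
  deriv u x * v x - u x * deriv v x

/-- The number of zeros of `f` in the closed disk `‖z‖ ≤ r`, counted with multiplicity. Meaningful for
an entire `f` that is not identically zero: then only finitely many terms are nonzero. -/
noncomputable def zeroCount (f : ℂ → ℂ) (r : ℝ) : ℕ :=
  ∑ᶠ z ∈ Metric.closedBall (0 : ℂ) r, analyticOrderNatAt f z

/-!
The function `b` is the Wronskian of `u₀` and `u z` at `1`. To the right of `1` the two equations
coincide, so the Wronskian is constant there by Lagrange's identity.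

*Analyticity and growth.* Everything rests on one estimate (`IsForcedSolution.energy_le`), a
Grönwall bound for the weighted energy `k |w| + |w'|` of a solution of `w'' = q w + f`. With
`k = 1 + |z| ^ (1/2)` it gives `|u z|, |(u z)'| ≤ A exp (c |z| ^ (1/2))` on `[0, 1]`
(`exists_growth`). With `k = 1` it shows that the difference quotients of `z ↦ u z x` are Cauchy
(`differentiable_coupling`), since a difference of two quotients solves the equation at the base
point with a small forcing term; hence `b` is entire.

*Zeros.* The zero count is Jensen's inequality, centred at a point where `b` does not vanish
(`Differentiable.zeroCount_isBigO`).

*`b` is not identically zero.* Suppose it is. Then the Cauchy data of `u z` at `1` are `μ z` times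
those of `u₀`. For real `s`, `t`, Lagrange's identity for `u s` and `conj (u t)` reads
`(s - t) ∫ V u_s conj(u_t) = (μ s conj(μ t) - 1) W₀`, where `W₀` is the constant Wronskian of `u₀` and
its conjugate. If `W₀ ≠ 0`, the case `s = t` shows `|μ| = 1` on the real axis. As `μ` is entire of
order at most `1/2`, the Phragmén–Lindelöf principle makes it bounded, hence constant
(`Differentiable.apply_eq_apply_of_order_half`). In either case the right-hand side vanishes, so
`∫ V u_s conj(u_t) = 0` for all real `s ≠ t`, and by continuity for `s = t`. This is impossible
(`IsSolutionFamily.exists_weighted_inner_ne_zero`): integrating by parts, the quadratic form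
`∫ |w'|² + Q |w|²` then vanishes for every `w` in the span of the `u_s` that is zero at `0` and `1`,
whereas it is positive on functions vanishing on a fine mesh of `[0, 1]`, finitely many linear
conditions. Since the `u_s` are linearly independent on `[0, 1]`
(`IsSolutionFamily.eq_zero_of_sum_eq_zero`), some nonzero `w` satisfies these conditions.
-/

open Set Filter Topology
open scoped ComplexConjugate

/-! ### Absolutely continuous functions -/

lemma LipschitzOnWith.comp_absolutelyContinuousOnInterval {X Y : Type*} [PseudoMetricSpace X]
    [PseudoMetricSpace Y] {φ : X → Y} {f : ℝ → X} {s : Set X} {K : NNReal} {a b : ℝ}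
    (hφ : LipschitzOnWith K φ s) (hf : AbsolutelyContinuousOnInterval f a b)
    (hs : MapsTo f (uIcc a b) s) :
    AbsolutelyContinuousOnInterval (fun x => φ (f x)) a b := by
  rw [absolutelyContinuousOnInterval_iff] at hf ⊢
  intro ε hε
  obtain ⟨δ, hδ, h⟩ := hf (ε / (K + 1)) (by positivity)
  refine ⟨δ, hδ, fun E hE hlen => ?_⟩
  have key : ∑ i ∈ Finset.range E.1, dist (φ (f (E.2 i).1)) (φ (f (E.2 i).2)) ≤
      K * ∑ i ∈ Finset.range E.1, dist (f (E.2 i).1) (f (E.2 i).2) := by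
    rw [Finset.mul_sum]
    refine Finset.sum_le_sum fun i hi => ?_
    have := hE.1 i hi
    exact hφ.dist_le_mul _ (hs this.1) _ (hs this.2)
  have h2 := h E hE hlen
  have h3 : (0 : ℝ) ≤ ∑ i ∈ Finset.range E.1, dist (f (E.2 i).1) (f (E.2 i).2) :=
    Finset.sum_nonneg fun _ _ => dist_nonneg
  have h4 : (K + 1 : ℝ) * ∑ i ∈ Finset.range E.1, dist (f (E.2 i).1) (f (E.2 i).2) < ε := by
    rwa [lt_div_iff₀ (by positivity), mul_comm] at h2
  nlinarith

lemma ContDiff.absolutelyContinuousOnInterval_comp {φ : ℝ → ℝ} (hφ : ContDiff ℝ 1 φ) {f : ℝ → ℝ}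
    {a b : ℝ} (hf : AbsolutelyContinuousOnInterval f a b) :
    AbsolutelyContinuousOnInterval (fun x => φ (f x)) a b := by
  obtain ⟨C, hC⟩ := hf.exists_bound
  obtain ⟨K, hK⟩ := hφ.contDiffOn (s := Icc (-C) C) |>.exists_lipschitzOnWith (by decide)
    (convex_Icc _ _) isCompact_Icc
  exact hK.comp_absolutelyContinuousOnInterval hf fun x hx => abs_le.1 (hC x hx)

/-- The fundamental theorem of calculus for complex-valued absolutely continuous functions. -/
lemma AbsolutelyContinuousOnInterval.intervalIntegrable_and_integral_eq_sub {f g : ℝ → ℂ} {a b : ℝ}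
    (hf : AbsolutelyContinuousOnInterval f a b) (h : ∀ᵐ x : ℝ, HasDerivAt f (g x) x) :
    IntervalIntegrable g volume a b ∧ ∫ x in a..b, g x = f b - f a := by
  have hre : AbsolutelyContinuousOnInterval (fun x => (f x).re) a b :=
    (Complex.reCLM.lipschitz.lipschitzOnWith (s := univ)).comp_absolutelyContinuousOnInterval hf
      (mapsTo_univ _ _)
  have him : AbsolutelyContinuousOnInterval (fun x => (f x).im) a b :=
    (Complex.imCLM.lipschitz.lipschitzOnWith (s := univ)).comp_absolutelyContinuousOnInterval hf
      (mapsTo_univ _ _)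
  have hre' : ∀ᵐ x : ℝ, deriv (fun x => (f x).re) x = (g x).re := by
    filter_upwards [h] with x hx
    exact (Complex.reCLM.hasFDerivAt.comp_hasDerivAt x hx).deriv
  have him' : ∀ᵐ x : ℝ, deriv (fun x => (f x).im) x = (g x).im := by
    filter_upwards [h] with x hx
    exact (Complex.imCLM.hasFDerivAt.comp_hasDerivAt x hx).deriv
  have ire : IntervalIntegrable (fun x => (g x).re) volume a b :=
    hre.intervalIntegrable_deriv.congr_ae (ae_restrict_of_ae hre')
  have iim : IntervalIntegrable (fun x => (g x).im) volume a b :=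
    him.intervalIntegrable_deriv.congr_ae (ae_restrict_of_ae him')
  have ere : ∫ x in a..b, (g x).re = (f b).re - (f a).re := by
    rw [← hre.integral_deriv_eq_sub]
    exact intervalIntegral.integral_congr_ae (hre'.mono fun x hx _ => hx.symm)
  have eim : ∫ x in a..b, (g x).im = (f b).im - (f a).im := by
    rw [← him.integral_deriv_eq_sub]
    exact intervalIntegral.integral_congr_ae (him'.mono fun x hx _ => hx.symm)
  have hg : g = fun x => ((g x).re : ℂ) + ((g x).im : ℂ) * Complex.I := by
    funext x; exact (Complex.re_add_im _).symm
  have i1 : IntervalIntegrable (fun x => ((g x).re : ℂ)) volume a b :=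
    ⟨ire.1.ofReal, ire.2.ofReal⟩
  have i2 : IntervalIntegrable (fun x => ((g x).im : ℂ) * Complex.I) volume a b :=
    IntervalIntegrable.mul_const ⟨iim.1.ofReal, iim.2.ofReal⟩ _
  refine ⟨by rw [hg]; exact i1.add i2, ?_⟩
  rw [hg, intervalIntegral.integral_add i1 i2, intervalIntegral.integral_mul_const,
    intervalIntegral.integral_ofReal, intervalIntegral.integral_ofReal, ere, eim]
  apply Complex.ext <;> simp

lemma MeasureTheory.LocallyIntegrable.intervalIntegrable {E : Type*} [NormedAddCommGroup E]
    {f : ℝ → E} (hf : LocallyIntegrable f volume) {a b : ℝ} : IntervalIntegrable f volume a b :=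
  (hf.integrableOn_isCompact isCompact_uIcc).intervalIntegrable

lemma AbsolutelyContinuousOnInterval.ae_differentiableAt_real {E : Type*} [NormedAddCommGroup E]
    [NormedSpace ℝ E] [FiniteDimensional ℝ E] {f : ℝ → E}
    (hf : ∀ a b, AbsolutelyContinuousOnInterval f a b) : ∀ᵐ x : ℝ, DifferentiableAt ℝ f x := by
  have h : ∀ᵐ x : ℝ, ∀ n : ℕ, x ∈ uIcc (-n : ℝ) n → DifferentiableAt ℝ f x :=
    ae_all_iff.2 fun n => (hf _ _).boundedVariationOn.ae_differentiableAt_of_mem_uIcc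
  filter_upwards [h] with x hx
  obtain ⟨n, hn⟩ := exists_nat_ge |x|
  refine hx n ?_
  have := abs_le.1 hn
  rw [uIcc_of_le (by linarith [abs_nonneg x])]
  exact this

/-! ### Grönwall's inequality with an integrable coefficient -/

/-- The product of `A + ∫ g y` and `exp (-∫ g)` is absolutely continuous with nonpositive
derivative. -/
lemma le_mul_exp_of_le_add_integral {y g : ℝ → ℝ} {a b A : ℝ} (hab : a ≤ b) (hy : Continuous y)
    (hg : IntervalIntegrable g volume a b) (hg0 : ∀ t, 0 ≤ g t)
    (h : ∀ t ∈ Icc a b, y t ≤ A + ∫ s in a..t, g s * y s) :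
    y b ≤ A * Real.exp (∫ s in a..b, g s) := by
  have hgy : IntervalIntegrable (fun s => g s * y s) volume a b :=
    hg.mul_continuousOn hy.continuousOn
  set G : ℝ → ℝ := fun t => ∫ s in a..t, g s with hG
  set Z : ℝ → ℝ := fun t => ∫ s in a..t, g s * y s with hZ
  have aG : AbsolutelyContinuousOnInterval G a b :=
    hg.absolutelyContinuousOnInterval_intervalIntegral left_mem_uIcc
  have aZ : AbsolutelyContinuousOnInterval Z a b :=
    hgy.absolutelyContinuousOnInterval_intervalIntegral left_mem_uIcc
  have aE : AbsolutelyContinuousOnInterval (fun t => Real.exp (-G t)) a b :=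
    ContDiff.absolutelyContinuousOnInterval_comp (φ := fun x => Real.exp (-x)) (by fun_prop) aG
  have aA : AbsolutelyContinuousOnInterval (fun t => A + Z t) a b :=
    AbsolutelyContinuousOnInterval.fun_add
      (contDiff_const (n := 1)).contDiffOn.absolutelyContinuousOnInterval aZ
  have aF := aA.fun_mul aE
  have hle : ∫ t in a..b, deriv (fun t => (A + Z t) * Real.exp (-G t)) t ≤ 0 := by
    have : ∀ᵐ t ∂(volume.restrict (Ioc a b)),
        deriv (fun t => (A + Z t) * Real.exp (-G t)) t ≤ 0 := by
      rw [ae_restrict_iff' measurableSet_Ioc]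
      filter_upwards [hg.ae_hasDerivAt_integral, hgy.ae_hasDerivAt_integral] with t h1 h2 ht
      have htu : t ∈ uIcc a b := by rw [uIcc_of_le hab]; exact Ioc_subset_Icc_self ht
      have d1 := h1 htu a left_mem_uIcc
      have d2 := h2 htu a left_mem_uIcc
      have d3 : HasDerivAt (fun t => (A + Z t) * Real.exp (-G t))
          ((g t * y t) * Real.exp (-G t) + (A + Z t) * (Real.exp (-G t) * (-g t))) t :=
        (d2.const_add A).mul d1.neg.exp
      rw [d3.deriv]
      have h4 := h t (Ioc_subset_Icc_self ht)
      have h5 : 0 ≤ g t * Real.exp (-G t) := mul_nonneg (hg0 t) (Real.exp_pos _).le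
      have h6 : y t ≤ A + Z t := h4
      nlinarith
    rw [intervalIntegral.integral_of_le hab]
    exact integral_nonpos_of_ae this
  rw [aF.integral_deriv_eq_sub] at hle
  have hGa : G a = 0 := by simp [hG]
  have hZa : Z a = 0 := by simp [hZ]
  rw [hGa, hZa] at hle
  have h7 : (A + Z b) * Real.exp (-G b) ≤ A := by simpa using hle
  calc y b ≤ A + Z b := h b (right_mem_Icc.2 hab)
    _ = (A + Z b) * Real.exp (-G b) * Real.exp (G b) := by
        rw [mul_assoc, ← Real.exp_add]; simp
    _ ≤ A * Real.exp (G b) := by gcongr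

/-- Two-sided form of `le_mul_exp_of_le_add_integral`. -/
lemma le_mul_exp_of_le_add_abs_integral {y g : ℝ → ℝ} {a b A : ℝ} (hy : Continuous y)
    (hg : IntervalIntegrable g volume a b) (hg0 : ∀ t, 0 ≤ g t) (hy0 : ∀ t, 0 ≤ y t)
    (h : ∀ t ∈ uIcc a b, y t ≤ A + |∫ s in a..t, g s * y s|) :
    y b ≤ A * Real.exp |∫ s in a..b, g s| := by
  have h0 : ∀ t, 0 ≤ g t * y t := fun t => mul_nonneg (hg0 t) (hy0 t)
  rcases le_total a b with hab | hab
  · rw [abs_of_nonneg (intervalIntegral.integral_nonneg hab fun t _ => hg0 t)]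
    refine le_mul_exp_of_le_add_integral hab hy hg hg0 fun t ht => ?_
    have := h t (by rwa [uIcc_of_le hab])
    rwa [abs_of_nonneg (intervalIntegral.integral_nonneg ht.1 fun t _ => h0 t)] at this
  · have key := le_mul_exp_of_le_add_integral (y := fun t => y (-t)) (g := fun t => g (-t))
      (a := -a) (b := -b) (A := A) (neg_le_neg hab) (by fun_prop)
      (by simpa using hg.comp_sub_left 0) (fun t => hg0 _) ?_
    · rw [intervalIntegral.integral_comp_neg, neg_neg, neg_neg] at key
      rw [intervalIntegral.integral_symm, abs_neg,
        abs_of_nonneg (intervalIntegral.integral_nonneg hab fun t _ => hg0 t)]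
      exact key
    · intro t ht
      have := h (-t) (by
        rw [uIcc_of_ge hab]; exact ⟨by linarith [ht.2], by linarith [ht.1]⟩)
      rw [intervalIntegral.integral_symm, abs_neg,
        abs_of_nonneg (intervalIntegral.integral_nonneg (by linarith [ht.1]) fun t _ => h0 t)]
        at this
      rw [intervalIntegral.integral_comp_neg (fun s => g s * y s), neg_neg]
      exact this

/-! ### Stability of the forced Schrödinger equation -/

/-- `w` solves the forced equation `w'' = q w + f` almost everywhere, with `w' = w₁` absolutely
continuous. -/
structure IsForcedSolution (q f w w₁ : ℝ → ℂ) : Prop where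
  hasDerivAt : ∀ x, HasDerivAt w (w₁ x) x
  absolutelyContinuous : ∀ a b, AbsolutelyContinuousOnInterval w₁ a b
  equation : ∀ᵐ x : ℝ, HasDerivAt w₁ (q x * w x + f x) x

namespace IsForcedSolution

variable {q f f' w w₁ v v₁ : ℝ → ℂ}

lemma continuous_deriv (h : IsForcedSolution q f w w₁) : Continuous w₁ := by
  rw [continuous_iff_continuousAt]
  intro x
  refine (h.absolutelyContinuous (x - 1) (x + 1)).continuousOn.continuousAt ?_
  rw [uIcc_of_le (by linarith)]
  exact Icc_mem_nhds (by linarith) (by linarith)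

lemma continuous (h : IsForcedSolution q f w w₁) : Continuous w :=
  continuous_iff_continuousAt.2 fun x => (h.hasDerivAt x).continuousAt

lemma absolutelyContinuous_self (h : IsForcedSolution q f w w₁) (a b : ℝ) :
    AbsolutelyContinuousOnInterval w a b := by
  have hd : deriv w = w₁ := funext fun x => (h.hasDerivAt x).deriv
  have : ContDiff ℝ 1 w := contDiff_one_iff_deriv.2
    ⟨fun x => (h.hasDerivAt x).differentiableAt, hd ▸ h.continuous_deriv⟩
  exact this.contDiffOn.absolutelyContinuousOnInterval

lemma sub (h : IsForcedSolution q f w w₁) (h' : IsForcedSolution q f' v v₁) :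
    IsForcedSolution q (fun x => f x - f' x) (fun x => w x - v x) (fun x => w₁ x - v₁ x) where
  hasDerivAt x := (h.hasDerivAt x).sub (h'.hasDerivAt x)
  absolutelyContinuous a b := (h.absolutelyContinuous a b).fun_sub (h'.absolutelyContinuous a b)
  equation := by
    filter_upwards [h.equation, h'.equation] with x h1 h2
    exact (h1.sub h2).congr_deriv (by ring)

lemma const_mul (c : ℂ) (h : IsForcedSolution q f w w₁) :
    IsForcedSolution q (fun x => c * f x) (fun x => c * w x) (fun x => c * w₁ x) where
  hasDerivAt x := (h.hasDerivAt x).const_mul c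
  absolutelyContinuous a b := (h.absolutelyContinuous a b).const_smul c
  equation := by
    filter_upwards [h.equation] with x h1
    exact (h1.const_mul c).congr_deriv (by ring)

lemma finset_sum {ι : Type*} (s : Finset ι) {F W W₁ : ι → ℝ → ℂ}
    (h : ∀ i ∈ s, IsForcedSolution q (F i) (W i) (W₁ i)) :
    IsForcedSolution q (fun x => ∑ i ∈ s, F i x) (fun x => ∑ i ∈ s, W i x)
      (fun x => ∑ i ∈ s, W₁ i x) where
  hasDerivAt x := HasDerivAt.fun_sum fun i hi => (h i hi).hasDerivAt x
  absolutelyContinuous a b := by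
    classical
    induction s using Finset.induction_on with
    | empty =>
      simpa using (contDiff_const (n := 1) (c := (0 : ℂ))).contDiffOn.absolutelyContinuousOnInterval
    | insert i t hi ih =>
      simp only [Finset.sum_insert hi]
      exact ((h i (by simp)).absolutelyContinuous a b).fun_add
        (ih fun j hj => h j (Finset.mem_insert_of_mem hj))
  equation := by
    have : ∀ᵐ x : ℝ, ∀ i ∈ s, HasDerivAt (W₁ i) (q x * W i x + F i x) x :=
      (Finset.eventually_all s).2 fun i hi => (h i hi).equation
    filter_upwards [this] with x hx
    refine (HasDerivAt.fun_sum fun i hi => hx i hi).congr_deriv ?_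
    rw [Finset.sum_add_distrib, Finset.mul_sum]

lemma norm_sub_le (h : IsForcedSolution q f w w₁) (a t : ℝ) :
    ‖w t‖ ≤ ‖w a‖ + |∫ s in a..t, ‖w₁ s‖| := by
  have e := ((h.absolutelyContinuous_self a t).intervalIntegrable_and_integral_eq_sub
    (ae_of_all _ h.hasDerivAt)).2
  have := intervalIntegral.norm_integral_le_abs_integral_norm (f := w₁) (a := a) (b := t)
    (μ := volume)
  rw [e] at this
  have h2 := norm_le_norm_add_norm_sub' (w t) (w a)
  linarith

/-- A weighted energy estimate: the parameter `k` balances `w` against `w'`. -/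
lemma energy_le (h : IsForcedSolution q f w w₁) {a b k : ℝ} (hk : 0 < k)
    (hq : IntervalIntegrable q volume a b) (hf : IntervalIntegrable f volume a b) :
    k * ‖w b‖ + ‖w₁ b‖ ≤ (k * ‖w a‖ + ‖w₁ a‖ + |∫ s in a..b, ‖f s‖|) *
      Real.exp |∫ s in a..b, (k + ‖q s‖ / k)| := by
  have hw := h.continuous
  have hw₁ := h.continuous_deriv
  refine le_mul_exp_of_le_add_abs_integral (y := fun t => k * ‖w t‖ + ‖w₁ t‖) (by fun_prop)
    (by
      refine (intervalIntegrable_const).add ?_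
      simpa [div_eq_mul_inv] using hq.norm.mul_const k⁻¹) (fun t => by positivity)
    (fun t => by positivity) fun t ht => ?_
  have hsub : uIcc a t ⊆ uIcc a b := uIcc_subset_uIcc left_mem_uIcc ht
  have hq' : IntervalIntegrable q volume a t := hq.mono_set hsub
  have hf' : IntervalIntegrable f volume a t := hf.mono_set hsub
  have i0 := hq'.mul_continuousOn hw.continuousOn
  have i1 : IntervalIntegrable (fun s => ‖q s‖ * ‖w s‖) volume a t := by
    simpa using i0.norm
  have i2 : IntervalIntegrable (fun s => ‖w₁ s‖) volume a t := hw₁.norm.intervalIntegrable _ _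
  have nn : ∀ {g : ℝ → ℝ} (c : ℝ), (∀ s, 0 ≤ g s) →
      |∫ s in a..c, g s| = ∫ s in uIoc a c, g s := fun {g} c hg => by
    rw [intervalIntegral.abs_integral_eq_abs_integral_uIoc,
      abs_of_nonneg (integral_nonneg hg)]
  have b1 := h.norm_sub_le a t
  rw [nn t fun _ => norm_nonneg _] at b1
  have b2 : ‖w₁ t‖ ≤ ‖w₁ a‖ + ∫ s in uIoc a t, (‖q s‖ * ‖w s‖ + ‖f s‖) := by
    have e := ((h.absolutelyContinuous a t).intervalIntegrable_and_integral_eq_sub h.equation).2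
    have h1 := intervalIntegral.norm_integral_le_integral_norm_uIoc
      (f := fun s => q s * w s + f s) (a := a) (b := t) (μ := volume)
    rw [e] at h1
    have h2 := norm_le_norm_add_norm_sub' (w₁ t) (w₁ a)
    have h3 : ∫ s in uIoc a t, ‖q s * w s + f s‖ ≤ ∫ s in uIoc a t, (‖q s‖ * ‖w s‖ + ‖f s‖) := by
      refine integral_mono (i0.add hf').norm.def' (i1.add hf'.norm).def' fun s => ?_
      exact (norm_add_le _ _).trans (by rw [norm_mul])
    linarith
  rw [integral_add i1.def' hf'.norm.def'] at b2
  have b3 : ∫ s in uIoc a t, ‖f s‖ ≤ ∫ s in uIoc a b, ‖f s‖ :=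
    setIntegral_mono_set hf.norm.def' (ae_of_all _ fun _ => norm_nonneg _)
      (uIoc_subset_uIoc_of_uIcc_subset_uIcc hsub).eventuallyLE
  have b4 : k * (∫ s in uIoc a t, ‖w₁ s‖) + ∫ s in uIoc a t, ‖q s‖ * ‖w s‖ ≤
      ∫ s in uIoc a t, (k + ‖q s‖ / k) * (k * ‖w s‖ + ‖w₁ s‖) := by
    rw [← integral_const_mul, ← integral_add (i2.def'.const_mul k) i1.def']
    refine integral_mono ((i2.def'.const_mul k).add i1.def') ?_ fun s => ?_
    · have i3 : IntervalIntegrable (fun s => k + ‖q s‖ / k) volume a t := by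
        refine (intervalIntegrable_const).add ?_
        simpa [div_eq_mul_inv] using hq'.norm.mul_const k⁻¹
      exact (i3.mul_continuousOn (g := fun s => k * ‖w s‖ + ‖w₁ s‖)
        (by fun_prop)).def'
    · have e : (k + ‖q s‖ / k) * (k * ‖w s‖ + ‖w₁ s‖) =
          k * ‖w₁ s‖ + ‖q s‖ * ‖w s‖ + (k * (k * ‖w s‖) + ‖q s‖ / k * ‖w₁ s‖) := by
        field_simp; ring
      change k * ‖w₁ s‖ + ‖q s‖ * ‖w s‖ ≤ (k + ‖q s‖ / k) * (k * ‖w s‖ + ‖w₁ s‖)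
      rw [e]
      have : 0 ≤ k * (k * ‖w s‖) + ‖q s‖ / k * ‖w₁ s‖ := by positivity
      linarith
  rw [nn t fun s => by positivity, nn b fun _ => norm_nonneg _]
  nlinarith

end IsForcedSolution

lemma IsSchrodingerSolution.isForcedSolution {q u : ℝ → ℂ} (h : IsSchrodingerSolution q u) :
    IsForcedSolution q (fun _ => 0) u (deriv u) where
  hasDerivAt x := (h.differentiable x).hasDerivAt
  absolutelyContinuous := h.deriv_absolutelyContinuous
  equation := by
    filter_upwards [h.equation,
      AbsolutelyContinuousOnInterval.ae_differentiableAt_real h.deriv_absolutelyContinuous]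
      with x hx hd
    refine hd.hasDerivAt.congr_deriv ?_
    linear_combination -hx

namespace IsForcedSolution

variable {q q' f f' w w₁ v v₁ : ℝ → ℂ}

lemma congr (h : IsForcedSolution q f w w₁) (e : ∀ x, q x * w x + f x = q' x * w x + f' x) :
    IsForcedSolution q' f' w w₁ where
  hasDerivAt := h.hasDerivAt
  absolutelyContinuous := h.absolutelyContinuous
  equation := by
    filter_upwards [h.equation] with x hx
    exact hx.congr_deriv (e x)

/-- Uniqueness for the homogeneous equation, from Cauchy data at an arbitrary point. -/
lemma eq_zero (h : IsForcedSolution q (fun _ => 0) w w₁) (hq : LocallyIntegrable q volume)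
    {a : ℝ} (h0 : w a = 0) (h1 : w₁ a = 0) (b : ℝ) : w b = 0 ∧ w₁ b = 0 := by
  have := h.energy_le (a := a) (b := b) one_pos (hq.intervalIntegrable) intervalIntegrable_const
  simp only [h0, h1, norm_zero, mul_zero, add_zero, intervalIntegral.integral_zero, abs_zero,
    zero_mul, one_mul] at this
  constructor <;> rw [← norm_le_zero_iff] <;> linarith [norm_nonneg (w b), norm_nonneg (w₁ b)]

/-- A solution with zero Cauchy data is controlled on `[0, 1]` by its forcing term. -/
lemma exists_norm_le_of_forcing (hq : LocallyIntegrable q volume) {V : ℝ → ℂ}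
    (hV : LocallyIntegrable V volume) :
    ∃ K : ℝ, 0 < K ∧ ∀ (g w w₁ : ℝ → ℂ) (D : ℝ), Continuous g → 0 ≤ D →
      (∀ x ∈ Icc (0 : ℝ) 1, ‖g x‖ ≤ D) →
      IsForcedSolution q (fun x => V x * g x) w w₁ → w 0 = 0 → w₁ 0 = 0 →
      ∀ x ∈ Icc (0 : ℝ) 1, ‖w x‖ ≤ K * D ∧ ‖w₁ x‖ ≤ K * D := by
  set A := ∫ s in (0 : ℝ)..1, ‖V s‖
  set B := ∫ s in (0 : ℝ)..1, (1 + ‖q s‖ / 1)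
  have hA : 0 ≤ A := intervalIntegral.integral_nonneg zero_le_one fun _ _ => norm_nonneg _
  refine ⟨(A + 1) * Real.exp B, by positivity, fun g w w₁ D hg hD hgD h h0 h1 x hx => ?_⟩
  have hVi : ∀ a b, IntervalIntegrable V volume a b := fun a b => hV.intervalIntegrable
  have hqi : ∀ a b, IntervalIntegrable q volume a b := fun a b => hq.intervalIntegrable
  have key := h.energy_le (a := 0) (b := x) one_pos (hqi _ _)
    ((hVi _ _).mul_continuousOn hg.continuousOn)
  have hsub : uIcc 0 x ⊆ uIcc (0 : ℝ) 1 :=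
    uIcc_subset_uIcc left_mem_uIcc (by rwa [uIcc_of_le zero_le_one])
  have e1 : |∫ s in (0 : ℝ)..x, ‖V s * g s‖| ≤ A * D := by
    rw [abs_of_nonneg (intervalIntegral.integral_nonneg hx.1 fun _ _ => norm_nonneg _)]
    calc ∫ s in (0 : ℝ)..x, ‖V s * g s‖ ≤ ∫ s in (0 : ℝ)..x, ‖V s‖ * D := by
          refine intervalIntegral.integral_mono_on hx.1
            ((hVi _ _).mul_continuousOn hg.continuousOn).norm ((hVi _ _).norm.mul_const D) ?_
          intro s hs
          rw [norm_mul]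
          exact mul_le_mul_of_nonneg_left (hgD s ⟨hs.1, hs.2.trans hx.2⟩) (norm_nonneg _)
      _ = (∫ s in (0 : ℝ)..x, ‖V s‖) * D := intervalIntegral.integral_mul_const _ _
      _ ≤ A * D := by
          gcongr
          exact intervalIntegral.integral_mono_interval le_rfl hx.1 hx.2
            (ae_of_all _ fun _ => norm_nonneg _) (hVi _ _).norm
  have e2 : |∫ s in (0 : ℝ)..x, (1 + ‖q s‖ / 1)| ≤ B := by
    rw [abs_of_nonneg (intervalIntegral.integral_nonneg hx.1 fun _ _ => by positivity)]
    refine intervalIntegral.integral_mono_interval le_rfl hx.1 hx.2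
      (ae_of_all _ fun _ => by change (0 : ℝ) ≤ _; positivity) ?_
    simpa using intervalIntegrable_const.add (hqi 0 1).norm
  have e3 : 1 * ‖w x‖ + ‖w₁ x‖ ≤ (A + 1) * Real.exp B * D := by
    refine key.trans ?_
    simp only [h0, h1, norm_zero, mul_zero, zero_add]
    calc _ ≤ A * D * Real.exp B := by gcongr
      _ ≤ _ := by nlinarith [Real.exp_pos B, mul_nonneg hD (Real.exp_pos B).le]
  constructor <;> linarith [norm_nonneg (w x), norm_nonneg (w₁ x)]

end IsForcedSolution

/-! ### Dependence on the coupling constant -/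

/-- `u z` are the solutions of `-u'' + Q u + z V u = 0`, with `u₁ z` their derivatives and with
Cauchy data at `0` independent of `z`. -/
structure IsSolutionFamily (Q V : ℝ → ℝ) (u u₁ : ℂ → ℝ → ℂ) : Prop where
  locallyIntegrable_Q : LocallyIntegrable Q volume
  locallyIntegrable_V : LocallyIntegrable V volume
  isForcedSolution : ∀ z, IsForcedSolution (fun x => (Q x : ℂ) + z * (V x : ℂ)) (fun _ => 0)
    (u z) (u₁ z)
  value_zero : ∀ z, u z 0 = u 0 0
  deriv_zero : ∀ z, u₁ z 0 = u₁ 0 0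

lemma locallyIntegrable_ofReal {Q : ℝ → ℝ} (hQ : LocallyIntegrable Q volume) :
    LocallyIntegrable (fun x => (Q x : ℂ)) volume := fun x => by
  obtain ⟨s, hs, h⟩ := hQ x
  exact ⟨s, hs, h.ofReal⟩

namespace IsSolutionFamily

variable {Q V : ℝ → ℝ} {u u₁ : ℂ → ℝ → ℂ}

lemma locallyIntegrable_potential (h : IsSolutionFamily Q V u u₁) (z : ℂ) :
    LocallyIntegrable (fun x => (Q x : ℂ) + z * (V x : ℂ)) volume :=
  (locallyIntegrable_ofReal h.locallyIntegrable_Q).add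
    ((locallyIntegrable_ofReal h.locallyIntegrable_V).smul z)

/-- Solutions grow at most like `exp (c |z| ^ (1/2))`: in the energy estimate the weight
`k = 1 + |z| ^ (1/2)` makes the coefficient `k + |Q + z V| / k` of order `k`. -/
lemma exists_growth (h : IsSolutionFamily Q V u u₁) :
    ∃ A c : ℝ, 0 < A ∧ 0 < c ∧ ∀ z : ℂ, ∀ x ∈ Icc (0 : ℝ) 1,
      ‖u z x‖ ≤ A * Real.exp (c * √‖z‖) ∧ ‖u₁ z x‖ ≤ A * Real.exp (c * √‖z‖) := by
  have hQi : IntervalIntegrable Q volume 0 1 := h.locallyIntegrable_Q.intervalIntegrable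
  have hVi : IntervalIntegrable V volume 0 1 := h.locallyIntegrable_V.intervalIntegrable
  set L := ∫ s in (0 : ℝ)..1, (1 + ‖Q s‖ + ‖V s‖) with hL
  set E := ‖u 0 0‖ + ‖u₁ 0 0‖
  have hL0 : 0 ≤ L := intervalIntegral.integral_nonneg zero_le_one fun _ _ => by positivity
  have hE : 0 ≤ E := by positivity
  refine ⟨(E + 1) * Real.exp (L + 1), L + 1, by positivity, by positivity, fun z x hx => ?_⟩
  set k := 1 + √‖z‖ with hk
  have hk1 : 1 ≤ k := by simp [hk]
  have hk0 : 0 < k := by linarith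
  have hzk : ‖z‖ ≤ k * k := by
    have := Real.mul_self_sqrt (norm_nonneg z)
    nlinarith [Real.sqrt_nonneg ‖z‖]
  have hqi : ∀ a b, IntervalIntegrable (fun x => (Q x : ℂ) + z * (V x : ℂ)) volume a b :=
    fun a b => (h.locallyIntegrable_potential z).intervalIntegrable
  have key := (h.isForcedSolution z).energy_le (a := 0) (b := x) hk0 (hqi _ _)
    intervalIntegrable_const
  have hgi : IntervalIntegrable (fun s => k + ‖(Q s : ℂ) + z * (V s : ℂ)‖ / k) volume 0 1 := by
    refine intervalIntegrable_const.add ?_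
    simpa [div_eq_mul_inv] using (hqi 0 1).norm.mul_const k⁻¹
  have e2 : |∫ s in (0 : ℝ)..x, (k + ‖(Q s : ℂ) + z * (V s : ℂ)‖ / k)| ≤ k * L := by
    rw [abs_of_nonneg (intervalIntegral.integral_nonneg hx.1 fun _ _ => by positivity)]
    calc _ ≤ ∫ s in (0 : ℝ)..1, (k + ‖(Q s : ℂ) + z * (V s : ℂ)‖ / k) :=
          intervalIntegral.integral_mono_interval le_rfl hx.1 hx.2
            (ae_of_all _ fun _ => by change (0 : ℝ) ≤ _; positivity) hgi
      _ ≤ ∫ s in (0 : ℝ)..1, k * (1 + ‖Q s‖ + ‖V s‖) := by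
          refine intervalIntegral.integral_mono_on zero_le_one hgi
            (((intervalIntegrable_const.add hQi.norm).add hVi.norm).const_mul k) fun s _ => ?_
          have h1 : ‖(Q s : ℂ) + z * (V s : ℂ)‖ ≤ ‖Q s‖ + ‖z‖ * ‖V s‖ := by
            refine (norm_add_le _ _).trans ?_
            rw [norm_mul, Complex.norm_real, Complex.norm_real]
          have h2 : ‖(Q s : ℂ) + z * (V s : ℂ)‖ / k ≤ k * ‖Q s‖ + k * ‖V s‖ := by
            rw [div_le_iff₀ hk0]
            nlinarith [norm_nonneg (Q s), norm_nonneg (V s),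
              mul_le_mul_of_nonneg_right hzk (norm_nonneg (V s)),
              mul_nonneg (norm_nonneg (Q s)) (by nlinarith : 0 ≤ k * k - 1)]
          linarith
      _ = k * L := intervalIntegral.integral_const_mul _ _
  have e3 : k * ‖u z x‖ + ‖u₁ z x‖ ≤ k * E * Real.exp (k * L) := by
    refine key.trans ?_
    rw [h.value_zero, h.deriv_zero]
    simp only [norm_zero, intervalIntegral.integral_zero, abs_zero, add_zero]
    gcongr
    nlinarith [norm_nonneg (u₁ 0 0)]
  have e4 : k * E * Real.exp (k * L) ≤
      (E + 1) * Real.exp (L + 1) * Real.exp ((L + 1) * √‖z‖) := by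
    have : k ≤ Real.exp k := by linarith [Real.add_one_le_exp k]
    calc k * E * Real.exp (k * L) ≤ Real.exp k * (E + 1) * Real.exp (k * L) := by
          gcongr; linarith
      _ = _ := by
          rw [mul_comm (Real.exp k), mul_assoc, mul_assoc, ← Real.exp_add, ← Real.exp_add]
          congr 2; rw [hk]; ring
  constructor
  · nlinarith [norm_nonneg (u z x), norm_nonneg (u₁ z x)]
  · nlinarith [norm_nonneg (u z x), norm_nonneg (u₁ z x)]

/-- The difference of the solutions at `z` and `z₀`, as a solution at `z₀` with forcing
`(z - z₀) V u z`. -/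
lemma sub_forced (h : IsSolutionFamily Q V u u₁) (z z₀ : ℂ) :
    IsForcedSolution (fun x => (Q x : ℂ) + z₀ * (V x : ℂ))
      (fun x => (V x : ℂ) * ((z - z₀) * u z x))
      (fun x => u z x - u z₀ x) (fun x => u₁ z x - u₁ z₀ x) :=
  ((((h.isForcedSolution z).congr (q' := fun x => (Q x : ℂ) + z₀ * (V x : ℂ))
    (f' := fun x => (V x : ℂ) * ((z - z₀) * u z x)) fun x => by ring).sub
    (h.isForcedSolution z₀))).congr fun x => by ring

/-- Locally Lipschitz dependence on the coupling constant, uniformly on `[0, 1]`. -/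
lemma exists_lipschitz (h : IsSolutionFamily Q V u u₁) (z₀ : ℂ) :
    ∃ C : ℝ, 0 < C ∧ ∀ z : ℂ, ‖z - z₀‖ ≤ 1 → ∀ x ∈ Icc (0 : ℝ) 1,
      ‖u z x - u z₀ x‖ ≤ C * ‖z - z₀‖ := by
  obtain ⟨A, c, hA, hc, hgr⟩ := h.exists_growth
  obtain ⟨K, hK, hKb⟩ := IsForcedSolution.exists_norm_le_of_forcing
    (h.locallyIntegrable_potential z₀) (locallyIntegrable_ofReal h.locallyIntegrable_V)
  set B := A * Real.exp (c * √(‖z₀‖ + 1))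
  refine ⟨K * B, by positivity, fun z hz x hx => ?_⟩
  have := (hKb (fun x => (z - z₀) * u z x) _ _ (‖z - z₀‖ * B)
    ((h.isForcedSolution z).continuous.const_mul _) (by positivity) (fun y hy => by
      rw [norm_mul]
      refine mul_le_mul_of_nonneg_left (((hgr z y hy).1).trans ?_) (norm_nonneg _)
      have : ‖z‖ ≤ ‖z₀‖ + 1 := by linarith [norm_le_norm_add_norm_sub' z z₀]
      simp only [B]
      gcongr) (h.sub_forced z z₀)
    (by simp only [h.value_zero z, h.value_zero z₀, sub_self])
    (by simp only [h.deriv_zero z, h.deriv_zero z₀, sub_self]) x hx).1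
  linarith

/-- Solutions depend holomorphically on the coupling constant: the difference quotients at `z₀`
form a Cauchy family, because the difference of two of them solves the equation at `z₀` with a
small forcing term. No existence theorem for the differentiated equation is required. -/
lemma differentiable_coupling (h : IsSolutionFamily Q V u u₁) {x : ℝ} (hx : x ∈ Icc (0 : ℝ) 1) :
    Differentiable ℂ (fun z => u z x) ∧ Differentiable ℂ (fun z => u₁ z x) := by
  have main : ∀ z₀ : ℂ, ∃ M : ℝ, 0 < M ∧ ∀ z z' : ℂ, z ≠ z₀ → z' ≠ z₀ → ‖z - z₀‖ ≤ 1 →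
      ‖z' - z₀‖ ≤ 1 →
      ‖(z - z₀)⁻¹ * (u z x - u z₀ x) - (z' - z₀)⁻¹ * (u z' x - u z₀ x)‖ ≤
        M * (‖z - z₀‖ + ‖z' - z₀‖) ∧
      ‖(z - z₀)⁻¹ * (u₁ z x - u₁ z₀ x) - (z' - z₀)⁻¹ * (u₁ z' x - u₁ z₀ x)‖ ≤
        M * (‖z - z₀‖ + ‖z' - z₀‖) := by
    intro z₀
    obtain ⟨C, hC, hCb⟩ := h.exists_lipschitz z₀
    obtain ⟨K, hK, hKb⟩ := IsForcedSolution.exists_norm_le_of_forcing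
      (h.locallyIntegrable_potential z₀) (locallyIntegrable_ofReal h.locallyIntegrable_V)
    refine ⟨K * C, by positivity, fun z z' hz hz' hz1 hz1' => ?_⟩
    have hz0 : z - z₀ ≠ 0 := sub_ne_zero.2 hz
    have hz0' : z' - z₀ ≠ 0 := sub_ne_zero.2 hz'
    have hs := (((h.sub_forced z z₀).const_mul (z - z₀)⁻¹).sub
      ((h.sub_forced z' z₀).const_mul (z' - z₀)⁻¹)).congr
      (q' := fun x => (Q x : ℂ) + z₀ * (V x : ℂ))
      (f' := fun x => (V x : ℂ) * (u z x - u z' x)) fun y => by field_simp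
    have := hKb _ _ _ (C * (‖z - z₀‖ + ‖z' - z₀‖))
      ((h.isForcedSolution z).continuous.sub (h.isForcedSolution z').continuous) (by positivity)
      (fun y hy => by
        have h1 := hCb z hz1 y hy
        have h2 := hCb z' hz1' y hy
        calc ‖u z y - u z' y‖ = ‖(u z y - u z₀ y) - (u z' y - u z₀ y)‖ := by congr 1; ring
          _ ≤ _ := (norm_sub_le _ _).trans (by linarith)) hs
      (by simp only [h.value_zero z, h.value_zero z', h.value_zero z₀, sub_self, mul_zero])
      (by simp only [h.deriv_zero z, h.deriv_zero z', h.deriv_zero z₀, sub_self, mul_zero]) x hx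
    constructor <;> linarith [this.1, this.2]
  have gen : ∀ F : ℂ → ℂ, (∀ z₀ : ℂ, ∃ M : ℝ, 0 < M ∧ ∀ z z' : ℂ, z ≠ z₀ → z' ≠ z₀ →
      ‖z - z₀‖ ≤ 1 → ‖z' - z₀‖ ≤ 1 →
      ‖(z - z₀)⁻¹ * (F z - F z₀) - (z' - z₀)⁻¹ * (F z' - F z₀)‖ ≤
        M * (‖z - z₀‖ + ‖z' - z₀‖)) → Differentiable ℂ F := by
    intro F hF z₀
    obtain ⟨M, hM, hMb⟩ := hF z₀
    have hc : Cauchy (map (slope F z₀) (𝓝[≠] z₀)) := by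
      rw [Metric.cauchy_iff]
      refine ⟨inferInstance, fun ε hε => ?_⟩
      set δ := min 1 (ε / (4 * M))
      have hδ : 0 < δ := by positivity
      refine ⟨slope F z₀ '' (Metric.ball z₀ δ ∩ {z₀}ᶜ),
        image_mem_map (inter_mem (mem_nhdsWithin_of_mem_nhds (Metric.ball_mem_nhds _ hδ))
          self_mem_nhdsWithin), ?_⟩
      rintro _ ⟨z, ⟨hz, hz0⟩, rfl⟩ _ ⟨z', ⟨hz', hz0'⟩, rfl⟩
      rw [mem_ball_iff_norm] at hz hz'
      have d1 : δ ≤ 1 := min_le_left _ _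
      have d2 : δ ≤ ε / (4 * M) := min_le_right _ _
      rw [le_div_iff₀ (by positivity)] at d2
      have := hMb z z' hz0 hz0' (hz.le.trans d1) (hz'.le.trans d1)
      rw [dist_eq_norm, slope_def_field, slope_def_field, div_eq_inv_mul, div_eq_inv_mul]
      refine this.trans_lt ?_
      nlinarith
    obtain ⟨d, hd⟩ := cauchy_iff_exists_le_nhds.1 hc
    exact (hasDerivAt_iff_tendsto_slope.2 hd).differentiableAt
  exact ⟨gen _ fun z₀ => (main z₀).imp fun M hM => ⟨hM.1, fun z z' a b c d => (hM.2 z z' a b c d).1⟩,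
    gen _ fun z₀ => (main z₀).imp fun M hM => ⟨hM.1, fun z z' a b c d => (hM.2 z z' a b c d).2⟩⟩

end IsSolutionFamily

/-! ### Wronskian and energy identities -/

namespace IsForcedSolution

variable {q q' f f' w w₁ v v₁ : ℝ → ℂ}

/-- Lagrange's identity for two homogeneous equations. -/
lemma wronskian_sub (h : IsForcedSolution q (fun _ => 0) w w₁)
    (h' : IsForcedSolution q' (fun _ => 0) v v₁) (a b : ℝ) :
    ∫ x in a..b, (q x - q' x) * w x * v x =
      (w₁ b * v b - w b * v₁ b) - (w₁ a * v a - w a * v₁ a) := by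
  have hac : AbsolutelyContinuousOnInterval (fun x => w₁ x * v x - w x * v₁ x) a b :=
    ((h.absolutelyContinuous a b).fun_smul (h'.absolutelyContinuous_self a b)).fun_sub
      ((h.absolutelyContinuous_self a b).fun_smul (h'.absolutelyContinuous a b))
  refine (hac.intervalIntegrable_and_integral_eq_sub ?_).2
  filter_upwards [h.equation, h'.equation] with x h1 h2
  exact ((h1.mul (h'.hasDerivAt x)).sub ((h.hasDerivAt x).mul h2)).congr_deriv (by ring)

lemma star (h : IsForcedSolution q f w w₁) :
    IsForcedSolution (fun x => conj (q x)) (fun x => conj (f x)) (fun x => conj (w x))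
      (fun x => conj (w₁ x)) where
  hasDerivAt x := Complex.conjCLE.toContinuousLinearMap.hasFDerivAt.comp_hasDerivAt x
    (h.hasDerivAt x)
  absolutelyContinuous a b :=
    (Complex.conjCLE.toContinuousLinearMap.lipschitz.lipschitzOnWith
      (s := univ)).comp_absolutelyContinuousOnInterval (h.absolutelyContinuous a b)
      (mapsTo_univ _ _)
  equation := by
    filter_upwards [h.equation] with x hx
    refine (Complex.conjCLE.toContinuousLinearMap.hasFDerivAt.comp_hasDerivAt x hx).congr_deriv ?_
    simp

/-- The energy identity `∫ |w'|² + q |w|² + f conj w = 0` for Dirichlet boundary values. -/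
lemma integral_energy (h : IsForcedSolution q f w w₁) {a b : ℝ} (ha : w a = 0) (hb : w b = 0) :
    ∫ x in a..b, (w₁ x * conj (w₁ x) + q x * (w x * conj (w x)) + f x * conj (w x)) = 0 := by
  have hac : AbsolutelyContinuousOnInterval (fun x => w₁ x * conj (w x)) a b :=
    (h.absolutelyContinuous a b).fun_smul (h.star.absolutelyContinuous_self a b)
  rw [(hac.intervalIntegrable_and_integral_eq_sub (g := fun x => w₁ x * conj (w₁ x) +
    q x * (w x * conj (w x)) + f x * conj (w x)) ?_).2]
  · simp [ha, hb]
  · filter_upwards [h.equation] with x hx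
    exact (hx.mul (h.star.hasDerivAt x)).congr_deriv (by ring)

end IsForcedSolution

/-! ### Positivity of the energy on functions vanishing on a mesh -/

/-- The Cauchy–Schwarz inequality against the constant function `1`. -/
lemma sq_intervalIntegral_le {g : ℝ → ℝ} (hg : Continuous g) {a b : ℝ} (hab : a ≤ b) :
    (∫ x in a..b, g x) ^ 2 ≤ (b - a) * ∫ x in a..b, g x ^ 2 := by
  rcases hab.eq_or_lt with rfl | hlt
  · simp
  have hl : 0 < b - a := by linarith
  set S := ∫ x in a..b, g x
  set c := S / (b - a)
  have i1 : IntervalIntegrable (fun x => g x ^ 2) volume a b := (hg.pow 2).intervalIntegrable _ _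
  have i2 : IntervalIntegrable (fun x => 2 * c * g x) volume a b :=
    (hg.const_mul _).intervalIntegrable _ _
  have h0 : 0 ≤ ∫ x in a..b, (g x ^ 2 - 2 * c * g x + c ^ 2) :=
    intervalIntegral.integral_nonneg hab fun x _ => by nlinarith [sq_nonneg (g x - c)]
  rw [intervalIntegral.integral_add (i1.sub i2) intervalIntegrable_const,
    intervalIntegral.integral_sub i1 i2, intervalIntegral.integral_const_mul,
    intervalIntegral.integral_const, smul_eq_mul] at h0
  have hc : c * (b - a) = S := div_mul_cancel₀ _ hl.ne'
  change 0 ≤ (∫ x in a..b, g x ^ 2) - 2 * c * S + (b - a) * c ^ 2 at h0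
  have h2 : S ^ 2 = (b - a) * (c * S) := by rw [← hc]; ring
  have h3 : (b - a) * c ^ 2 = c * S := by rw [← hc]; ring
  nlinarith

/-- A function vanishing on the mesh `{j / N}` of `[0, 1]` is small in terms of its derivative. -/
lemma sq_norm_le_of_mesh {w w₁ : ℝ → ℂ} (h : ∀ x, HasDerivAt w (w₁ x) x) (hc : Continuous w₁)
    {N : ℕ} (hN : 0 < N) (h0 : ∀ j : ℕ, j ≤ N → w (j / N) = 0) {x : ℝ} (hx : x ∈ Icc (0 : ℝ) 1) :
    ‖w x‖ ^ 2 ≤ (1 / N) * ∫ t in (0 : ℝ)..1, ‖w₁ t‖ ^ 2 := by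
  have hN' : (0 : ℝ) < N := by exact_mod_cast hN
  set j := ⌊N * x⌋₊
  have hj1 : (j : ℝ) ≤ N * x := Nat.floor_le (by have := hx.1; positivity)
  have hj2 : N * x < j + 1 := Nat.lt_floor_add_one _
  have hjN : j ≤ N := by
    have : (j : ℝ) ≤ N := hj1.trans (by nlinarith [hx.2])
    exact_mod_cast this
  set a : ℝ := j / N with ha
  have haN : a * N = j := div_mul_cancel₀ _ hN'.ne'
  have hax : a ≤ x := by nlinarith
  have hxa : x - a ≤ 1 / N := by rw [le_div_iff₀ hN']; nlinarith
  have ha0 : 0 ≤ a := by positivity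
  have e : w x = ∫ t in a..x, w₁ t := by
    rw [intervalIntegral.integral_eq_sub_of_hasDerivAt (fun t _ => h t)
      (hc.intervalIntegrable _ _), h0 j hjN, sub_zero]
  have h1 : ‖w x‖ ≤ ∫ t in a..x, ‖w₁ t‖ := by
    rw [e]; exact intervalIntegral.norm_integral_le_integral_norm hax
  have hsq : Continuous fun t => ‖w₁ t‖ ^ 2 := by fun_prop
  calc ‖w x‖ ^ 2 ≤ (∫ t in a..x, ‖w₁ t‖) ^ 2 := by gcongr
    _ ≤ (x - a) * ∫ t in a..x, ‖w₁ t‖ ^ 2 := sq_intervalIntegral_le hc.norm hax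
    _ ≤ (x - a) * ∫ t in (0 : ℝ)..1, ‖w₁ t‖ ^ 2 := by
        refine mul_le_mul_of_nonneg_left ?_ (by linarith)
        exact intervalIntegral.integral_mono_interval ha0 hax hx.2
          (ae_of_all _ fun _ => by change (0 : ℝ) ≤ _; positivity) (hsq.intervalIntegrable _ _)
    _ ≤ _ := by
        refine mul_le_mul_of_nonneg_right hxa ?_
        exact intervalIntegral.integral_nonneg zero_le_one fun _ _ => by positivity

/-- Positivity of the quadratic form `∫ |w'|² + Q |w|²` on functions vanishing on a fine mesh. -/
lemma IsForcedSolution.eq_zero_of_mesh {Q : ℝ → ℝ} {f w w₁ : ℝ → ℂ}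
    (h : IsForcedSolution (fun x => (Q x : ℂ)) f w w₁) (hQ : IntervalIntegrable Q volume 0 1)
    (hf : IntervalIntegrable f volume 0 1) {N : ℕ} (hN : ∫ x in (0 : ℝ)..1, |Q x| < N)
    (h0 : ∀ j : ℕ, j ≤ N → w (j / N) = 0) (hfw : ∫ x in (0 : ℝ)..1, f x * conj (w x) = 0)
    {x : ℝ} (hx : x ∈ Icc (0 : ℝ) 1) : w x = 0 := by
  have hw := h.continuous
  have hw₁ := h.continuous_deriv
  have hq0 : 0 ≤ ∫ x in (0 : ℝ)..1, |Q x| :=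
    intervalIntegral.integral_nonneg zero_le_one fun _ _ => abs_nonneg _
  have hN' : (0 : ℝ) < N := hq0.trans_lt hN
  have hN0 : 0 < N := by exact_mod_cast hN'
  set T := ∫ t in (0 : ℝ)..1, ‖w₁ t‖ ^ 2 with hT
  have hT0 : 0 ≤ T := intervalIntegral.integral_nonneg zero_le_one fun _ _ => by positivity
  have hmesh := fun y hy => sq_norm_le_of_mesh h.hasDerivAt hw₁ hN0 h0 (x := y) hy
  have i2 : IntervalIntegrable (fun x => Q x * ‖w x‖ ^ 2) volume 0 1 :=
    hQ.mul_continuousOn (by fun_prop)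
  have i1 : IntervalIntegrable (fun x => ‖w₁ x‖ ^ 2) volume 0 1 :=
    Continuous.intervalIntegrable (by fun_prop) _ _
  have hen := h.integral_energy (a := 0) (b := 1) (by simpa using h0 0 (Nat.zero_le _))
    (by simpa [hN'.ne'] using h0 N le_rfl)
  have i3 : IntervalIntegrable (fun x => f x * conj (w x)) volume 0 1 :=
    hf.mul_continuousOn (Complex.continuous_conj.comp hw).continuousOn
  have i4 : IntervalIntegrable (fun x => ((‖w₁ x‖ ^ 2 + Q x * ‖w x‖ ^ 2 : ℝ) : ℂ)) volume 0 1 :=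
    ⟨(i1.add i2).1.ofReal, (i1.add i2).2.ofReal⟩
  have hen2 : ∫ x in (0 : ℝ)..1, (‖w₁ x‖ ^ 2 + Q x * ‖w x‖ ^ 2) = 0 := by
    have e : ∀ x, w₁ x * conj (w₁ x) + (Q x : ℂ) * (w x * conj (w x)) + f x * conj (w x) =
        ((‖w₁ x‖ ^ 2 + Q x * ‖w x‖ ^ 2 : ℝ) : ℂ) + f x * conj (w x) := fun x => by
      rw [Complex.mul_conj', Complex.mul_conj']; push_cast; ring
    simp only [e] at hen
    rw [intervalIntegral.integral_add i4 i3, hfw, add_zero, intervalIntegral.integral_ofReal]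
      at hen
    exact_mod_cast hen
  rw [intervalIntegral.integral_add i1 i2] at hen2
  have hlow : -((∫ x in (0 : ℝ)..1, |Q x|) * (1 / N * T)) ≤
      ∫ x in (0 : ℝ)..1, Q x * ‖w x‖ ^ 2 := by
    rw [← intervalIntegral.integral_mul_const, ← intervalIntegral.integral_neg]
    refine intervalIntegral.integral_mono_on zero_le_one (hQ.abs.mul_const _).neg i2
      fun y hy => ?_
    have := hmesh y hy
    have h3 : -(|Q y|) * ‖w y‖ ^ 2 ≤ Q y * ‖w y‖ ^ 2 := by
      gcongr; exact neg_abs_le _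
    have h4 := mul_le_mul_of_nonneg_left this (abs_nonneg (Q y))
    linarith
  have hTle : T ≤ 0 := by
    have h5 : T * N ≤ (∫ x in (0 : ℝ)..1, |Q x|) * T := by
      have : T ≤ (∫ x in (0 : ℝ)..1, |Q x|) * (1 / N * T) := by linarith
      calc T * N ≤ (∫ x in (0 : ℝ)..1, |Q x|) * (1 / N * T) * N := by gcongr
        _ = _ := by field_simp
    nlinarith
  have h6 := hmesh x hx
  have h7 : ‖w x‖ ^ 2 ≤ 0 := h6.trans (mul_nonpos_of_nonneg_of_nonpos (by positivity) hTle)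
  have h8 : ‖w x‖ = 0 := by nlinarith [norm_nonneg (w x)]
  exact norm_eq_zero.1 h8

/-! ### Solutions at different couplings are not all orthogonal with weight `V` -/

/-- If `f` vanishes almost everywhere on `S`, so does `deriv f`: only countably many points of a
set of real numbers are isolated in it from the right. -/
lemma ae_deriv_eq_zero_of_ae_eq_zero {E : Type*} [NormedAddCommGroup E] [NormedSpace ℝ E]
    {f : ℝ → E} {S : Set ℝ} (h : ∀ᵐ x : ℝ, x ∈ S → f x = 0) :
    ∀ᵐ x : ℝ, x ∈ S → deriv f x = 0 := by
  set A := {x ∈ S | f x = 0} with hA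
  have hB := (countable_setOfPred_isolated_right_within (s := A)).ae_notMem volume
  filter_upwards [h, hB] with x hx hxB hxS
  have hxA : x ∈ A := ⟨hxS, hx hxS⟩
  have hne : (𝓝[A ∩ Ioi x] x).NeBot := ⟨fun hbot => hxB ⟨hxA, hbot⟩⟩
  by_cases hd : DifferentiableAt ℝ f x
  · have ht : Tendsto (slope f x) (𝓝[A ∩ Ioi x] x) (𝓝 (deriv f x)) :=
      (hasDerivAt_iff_tendsto_slope.1 hd.hasDerivAt).mono_left
        (nhdsWithin_mono _ fun y hy => (ne_of_gt hy.2 : y ≠ x))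
    refine tendsto_nhds_unique ht (tendsto_const_nhds.congr' ?_)
    filter_upwards [self_mem_nhdsWithin] with y hy
    rw [slope_def_module, hy.1.2, hxA.2, sub_zero, smul_zero]
  · exact deriv_zero_of_not_differentiableAt hd

namespace IsSolutionFamily

variable {Q V : ℝ → ℝ} {u u₁ : ℂ → ℝ → ℂ}

lemma intervalIntegrable_weight_mul (h : IsSolutionFamily Q V u u₁) (s t : ℂ) :
    IntervalIntegrable (fun x => (V x : ℂ) * (u s x * conj (u t x))) volume 0 1 :=
  (locallyIntegrable_ofReal h.locallyIntegrable_V).intervalIntegrable.mul_continuousOn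
    ((h.isForcedSolution s).continuous.mul
      (Complex.continuous_conj.comp (h.isForcedSolution t).continuous)).continuousOn

lemma continuous_weighted_inner (h : IsSolutionFamily Q V u u₁) (s : ℂ) :
    Continuous fun t : ℝ => ∫ x in (0 : ℝ)..1, (V x : ℂ) * (u s x * conj (u t x)) := by
  obtain ⟨A, c, hA, hc, hgr⟩ := h.exists_growth
  rw [continuous_iff_continuousAt]
  intro t₀
  have hVi : IntervalIntegrable V volume 0 1 := h.locallyIntegrable_V.intervalIntegrable
  set B := A * Real.exp (c * √(|t₀| + 1))
  refine intervalIntegral.continuousAt_of_dominated_interval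
    (bound := fun x => ‖V x‖ * (A * Real.exp (c * √‖s‖) * B)) ?_ ?_ (hVi.norm.mul_const _) ?_
  · exact Eventually.of_forall fun t => (h.intervalIntegrable_weight_mul s t).def'.1
  · filter_upwards [Metric.ball_mem_nhds t₀ one_pos] with t ht
    refine ae_of_all _ fun x hx => ?_
    rw [uIoc_of_le zero_le_one] at hx
    have hx' := Ioc_subset_Icc_self hx
    rw [norm_mul, norm_mul, Complex.norm_real, RCLike.norm_conj]
    have h1 := (hgr s x hx').1
    have h2 : ‖u t x‖ ≤ B := by
      refine ((hgr t x hx').1).trans ?_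
      have : ‖(t : ℂ)‖ ≤ |t₀| + 1 := by
        rw [Complex.norm_real, Real.norm_eq_abs]
        rw [mem_ball_iff_norm, Real.norm_eq_abs] at ht
        have := abs_sub_abs_le_abs_sub t t₀
        linarith
      simp only [B]
      gcongr
    gcongr
  · refine ae_of_all _ fun x hx => ?_
    rw [uIoc_of_le zero_le_one] at hx
    have hd := (h.differentiable_coupling (Ioc_subset_Icc_self hx)).1.continuous
    have : Continuous fun t : ℝ => (V x : ℂ) * (u s x * conj (u t x)) :=
      continuous_const.mul (continuous_const.mul
        (Complex.continuous_conj.comp (hd.comp Complex.continuous_ofReal)))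
    exact this.continuousAt

/-- `∑ cᵢ sᵢᵏ u(sᵢ)` solves the equation with potential `Q`, forced by `V` times the same
expression with `k + 1`. -/
lemma sum_forced (h : IsSolutionFamily Q V u u₁) {ι : Type*} [Fintype ι] (s c : ι → ℂ) (k : ℕ) :
    IsForcedSolution (fun x => (Q x : ℂ))
      (fun x => (V x : ℂ) * ∑ i, c i * s i ^ (k + 1) * u (s i) x)
      (fun x => ∑ i, c i * s i ^ k * u (s i) x) (fun x => ∑ i, c i * s i ^ k * u₁ (s i) x) := by
  have := IsForcedSolution.finset_sum (q := fun x => (Q x : ℂ)) Finset.univ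
    (F := fun i x => c i * s i ^ k * (V x * (s i * u (s i) x)))
    (W := fun i x => c i * s i ^ k * u (s i) x) (W₁ := fun i x => c i * s i ^ k * u₁ (s i) x)
    fun i _ => IsForcedSolution.const_mul (c i * s i ^ k)
      ((h.isForcedSolution (s i)).congr fun x => by ring)
  refine this.congr fun x => ?_
  rw [Finset.mul_sum, Finset.mul_sum]
  congr 1
  exact Finset.sum_congr rfl fun i _ => by ring

/-- Solutions at distinct couplings are linearly independent on `[0, 1]`. If `w₀ = ∑ cᵢ u(sᵢ)`
vanishes there, then inductively `wₖ = ∑ cᵢ sᵢᵏ u(sᵢ)` and `wₖ'` vanish almost everywhere on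
`{V ≠ 0}`, as `wₖ'' = Q wₖ + V wₖ₊₁`; a Vandermonde determinant then separates the summands. -/
lemma eq_zero_of_sum_eq_zero (h : IsSolutionFamily Q V u u₁)
    (hne : ¬ (u 0 0 = 0 ∧ u₁ 0 0 = 0))
    (hV : ¬ ∀ᵐ x : ℝ, x ∈ Icc (0 : ℝ) 1 → V x = 0) {n : ℕ} {s c : Fin n → ℂ}
    (hs : Function.Injective s)
    (h0 : ∀ x ∈ Icc (0 : ℝ) 1, ∑ i, c i * u (s i) x = 0) : c = 0 := by
  set S := {x : ℝ | x ∈ Icc (0 : ℝ) 1 ∧ V x ≠ 0} with hS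
  have hderiv : ∀ k, (∀ᵐ x : ℝ, x ∈ S → ∑ i, c i * s i ^ k * u (s i) x = 0) →
      ∀ᵐ x : ℝ, x ∈ S → ∑ i, c i * s i ^ k * u₁ (s i) x = 0 := fun k hk => by
    filter_upwards [ae_deriv_eq_zero_of_ae_eq_zero hk] with x hx hxS
    rw [← ((h.sum_forced s c k).hasDerivAt x).deriv]
    exact hx hxS
  have hval : ∀ k, ∀ᵐ x : ℝ, x ∈ S → ∑ i, c i * s i ^ k * u (s i) x = 0 := by
    intro k
    induction k with
    | zero => exact ae_of_all _ fun x hx => by simpa using h0 x hx.1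
    | succ k ih =>
      filter_upwards [ih, ae_deriv_eq_zero_of_ae_eq_zero (hderiv k ih),
        (h.sum_forced s c k).equation] with x h1 h2 h3 hxS
      have h4 := h3.deriv
      rw [h2 hxS, h1 hxS, mul_zero, zero_add] at h4
      exact (mul_eq_zero.1 h4.symm).resolve_left (Complex.ofReal_ne_zero.2 hxS.2)
  have hall : ∀ᵐ x : ℝ, ∀ k, x ∈ S → ∑ i, c i * s i ^ k * u (s i) x = 0 ∧
      ∑ i, c i * s i ^ k * u₁ (s i) x = 0 :=
    ae_all_iff.2 fun k => by
      filter_upwards [hval k, hderiv k (hval k)] with x h1 h2 hx using ⟨h1 hx, h2 hx⟩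
  obtain ⟨x₀, hx₀S, hx₀⟩ : ∃ x₀ ∈ S, ∀ k, ∑ i, c i * s i ^ k * u (s i) x₀ = 0 ∧
      ∑ i, c i * s i ^ k * u₁ (s i) x₀ = 0 := by
    by_contra hcon
    push Not at hcon
    refine hV ?_
    filter_upwards [hall] with x hx hxI
    by_contra hVx
    obtain ⟨k, hk⟩ := hcon x ⟨hxI, hVx⟩
    exact hk (hx k ⟨hxI, hVx⟩).1 (hx k ⟨hxI, hVx⟩).2
  have v1 : (fun i => c i * u (s i) x₀) = 0 :=
    Matrix.eq_zero_of_forall_pow_sum_mul_pow_eq_zero hs fun k => by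
      rw [← (hx₀ k).1]; exact Finset.sum_congr rfl fun i _ => by ring
  have v2 : (fun i => c i * u₁ (s i) x₀) = 0 :=
    Matrix.eq_zero_of_forall_pow_sum_mul_pow_eq_zero hs fun k => by
      rw [← (hx₀ k).2]; exact Finset.sum_congr rfl fun i _ => by ring
  funext i
  by_contra hci
  have e1 := (mul_eq_zero.1 (congrFun v1 i)).resolve_left hci
  have e2 := (mul_eq_zero.1 (congrFun v2 i)).resolve_left hci
  have := (h.isForcedSolution (s i)).eq_zero (h.locallyIntegrable_potential (s i)) e1 e2 0
  rw [h.value_zero, h.deriv_zero] at this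
  exact hne this

/-- If all weighted inner products vanished, the form `∫ |w'|² + Q |w|²` would be zero on the
infinite-dimensional span of the solutions, while it is positive on the subspace of finite
codimension cut out by the zeros at a fine mesh. -/
theorem exists_weighted_inner_ne_zero (h : IsSolutionFamily Q V u u₁)
    (hne : ¬ (u 0 0 = 0 ∧ u₁ 0 0 = 0))
    (hV : ¬ ∀ᵐ x : ℝ, x ∈ Icc (0 : ℝ) 1 → V x = 0) :
    ∃ s t : ℝ, s ≠ t ∧ ∫ x in (0 : ℝ)..1, (V x : ℂ) * (u s x * conj (u t x)) ≠ 0 := by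
  by_contra hcon
  push Not at hcon
  have hzero : ∀ s t : ℝ, ∫ x in (0 : ℝ)..1, (V x : ℂ) * (u s x * conj (u t x)) = 0 := by
    intro s t
    rcases ne_or_eq s t with hst | rfl
    · exact hcon s t hst
    · -- Lagrange's identity says nothing on the diagonal, which is reached by continuity.
      refine tendsto_nhds_unique (((h.continuous_weighted_inner s).tendsto s).mono_left
        (nhdsWithin_le_nhds (s := {s}ᶜ))) (tendsto_const_nhds.congr' ?_)
      filter_upwards [self_mem_nhdsWithin] with t ht
      exact (hcon s t (Ne.symm ht)).symm
  obtain ⟨N, hN⟩ := exists_nat_gt (∫ x in (0 : ℝ)..1, |Q x|)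
  -- `N + 2` real couplings against the `N + 1` conditions `w (j / N) = 0`.
  set s : Fin (N + 2) → ℂ := fun i => (((i : ℕ) : ℝ) : ℂ) with hs
  have hsinj : Function.Injective s := fun i j hij => by
    have : ((i : ℕ) : ℝ) = ((j : ℕ) : ℝ) := Complex.ofReal_injective hij
    exact Fin.ext (by exact_mod_cast this)
  set M : Matrix (Fin (N + 1)) (Fin (N + 2)) ℂ :=
    Matrix.of fun j i => u (s i) ((j : ℕ) / (N : ℝ)) with hM
  have hker : LinearMap.ker M.mulVecLin ≠ ⊥ := LinearMap.ker_ne_bot_of_finrank_lt (by simp)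
  obtain ⟨c, hc, hc0⟩ := (Submodule.ne_bot_iff _).1 hker
  refine hc0 (h.eq_zero_of_sum_eq_zero hne hV hsinj fun x hx => ?_)
  have hf := h.sum_forced s c 0
  have hfc : Continuous fun x => ∑ i, c i * s i ^ (0 + 1) * u (s i) x :=
    continuous_finsetSum _ fun i _ => (h.isForcedSolution (s i)).continuous.const_mul _
  have := hf.eq_zero_of_mesh (N := N) h.locallyIntegrable_Q.intervalIntegrable
    ((locallyIntegrable_ofReal h.locallyIntegrable_V).intervalIntegrable.mul_continuousOn
      hfc.continuousOn) hN ?_ ?_ hx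
  · simpa using this
  · intro j hj
    have := congrFun (LinearMap.mem_ker.1 hc) ⟨j, Nat.lt_succ_of_le hj⟩
    simp only [Matrix.mulVecLin_apply, Matrix.mulVec, dotProduct, hM, Matrix.of_apply,
      Pi.zero_apply] at this
    rw [← this]
    exact Finset.sum_congr rfl fun i _ => by ring
  · have e : ∀ x, (V x : ℂ) * (∑ i, c i * s i ^ (0 + 1) * u (s i) x) *
        conj (∑ i, c i * s i ^ 0 * u (s i) x) =
        ∑ i, ∑ j, (c i * s i * conj (c j)) * ((V x : ℂ) * (u (s i) x * conj (u (s j) x))) := by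
      intro x
      rw [map_sum, mul_assoc, Finset.sum_mul_sum, Finset.mul_sum]
      refine Finset.sum_congr rfl fun i _ => ?_
      rw [Finset.mul_sum]
      refine Finset.sum_congr rfl fun j _ => ?_
      simp only [map_mul, pow_zero, mul_one, zero_add, pow_one]
      ring
    simp only [e]
    have hint : ∀ i j, IntervalIntegrable (fun x => (c i * s i * conj (c j)) *
        ((V x : ℂ) * (u (s i) x * conj (u (s j) x)))) volume 0 1 := fun i j =>
      (h.intervalIntegrable_weight_mul _ _).const_mul _
    rw [intervalIntegral.integral_finsetSum fun i _ => by
      simpa only [Finset.sum_fn] using IntervalIntegrable.sum Finset.univ fun j _ => hint i j]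
    refine Finset.sum_eq_zero fun i _ => ?_
    rw [intervalIntegral.integral_finsetSum fun j _ => hint i j]
    refine Finset.sum_eq_zero fun j _ => ?_
    rw [intervalIntegral.integral_const_mul, hzero, mul_zero]

end IsSolutionFamily

/-! ### Entire functions of order at most one half -/

/-- Phragmén–Lindelöf: `w ↦ f (w²)` has exponential type, which is admissible in a quadrant, and
it is bounded on both axes. -/
lemma Differentiable.apply_eq_apply_of_order_half {f : ℂ → ℂ} (hf : Differentiable ℂ f) {A c B : ℝ}
    (hgr : ∀ z, ‖f z‖ ≤ A * Real.exp (c * √‖z‖)) (hB : ∀ x : ℝ, ‖f x‖ ≤ B) (z z' : ℂ) :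
    f z = f z' := by
  set g : ℂ → ℂ := fun w => f (w ^ 2) with hg
  have hgd : Differentiable ℂ g := hf.comp (differentiable_id.pow 2)
  have hgO : ∀ l : Filter ℂ, g =O[l] fun w => Real.exp (c * ‖w‖ ^ (1 : ℝ)) := fun l => by
    refine Asymptotics.IsBigO.of_bound A (Eventually.of_forall fun w => ?_)
    have := hgr (w ^ 2)
    rw [norm_pow, Real.sqrt_sq (norm_nonneg _)] at this
    rwa [Real.norm_of_nonneg (Real.exp_pos _).le, Real.rpow_one]
  have hre : ∀ x : ℝ, ‖g x‖ ≤ B := fun x => by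
    have := hB (x ^ 2)
    simpa [hg] using this
  have him : ∀ x : ℝ, ‖g (x * Complex.I)‖ ≤ B := fun x => by
    have := hB (-x ^ 2)
    simpa [hg, mul_pow] using this
  have hbound : ∀ z, ‖f z‖ ≤ B := by
    intro z
    obtain ⟨w, hw⟩ := IsAlgClosed.exists_pow_nat_eq z (n := 2) (by norm_num)
    have hright : ∀ w : ℂ, 0 ≤ w.re → ‖g w‖ ≤ B := fun w hw => by
      rcases le_total 0 w.im with hi | hi
      · exact PhragmenLindelof.quadrant_I hgd.diffContOnCl ⟨1, by norm_num, c, hgO _⟩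
          (fun x _ => hre x) (fun x _ => him x) hw hi
      · exact PhragmenLindelof.quadrant_IV hgd.diffContOnCl ⟨1, by norm_num, c, hgO _⟩
          (fun x _ => hre x) (fun x _ => him x) hw hi
    rcases le_total 0 w.re with h | h
    · simpa [hg, hw] using hright w h
    · simpa [hg, hw] using hright (-w) (by simpa using h)
  refine hf.apply_eq_apply_of_bounded ?_ z z'
  exact (isBounded_iff_forall_norm_le).2 ⟨B, by rintro _ ⟨z, rfl⟩; exact hbound z⟩

section ZeroCount

variable {f : ℂ → ℂ}

lemma Differentiable.analyticOrderAt_ne_top (hf : Differentiable ℂ f) {z₀ : ℂ} (h0 : f z₀ ≠ 0)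
    (z : ℂ) : analyticOrderAt f z ≠ ⊤ := by
  intro htop
  rw [analyticOrderAt_eq_top] at htop
  have := AnalyticOnNhd.eq_of_eventuallyEq (f := f) (g := fun _ => 0)
    (fun z _ => hf.analyticAt z) (fun z _ => analyticAt_const) htop
  exact h0 (congrFun this z₀)

lemma Differentiable.divisor_eq_analyticOrderNatAt (hf : Differentiable ℂ f) {z₀ : ℂ}
    (h0 : f z₀ ≠ 0) {U : Set ℂ} {z : ℂ} (hz : z ∈ U) :
    MeromorphicOn.divisor f U z = (analyticOrderNatAt f z : ℤ) := by
  rw [MeromorphicOn.AnalyticOnNhd.divisor_apply (fun z _ => hf.analyticAt z) hz, analyticOrderNatAt]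
  obtain ⟨n, hn⟩ := ENat.ne_top_iff_exists.1 (hf.analyticOrderAt_ne_top h0 z)
  rw [← hn]
  rfl

lemma Differentiable.finite_zeros_norm_le (hf : Differentiable ℂ f) {z₀ : ℂ} (h0 : f z₀ ≠ 0)
    (r : ℝ) : {z : ℂ | ‖z‖ ≤ r ∧ f z = 0}.Finite := by
  refine ((MeromorphicOn.divisor f (Metric.closedBall (0 : ℂ) r)).finiteSupport
    (isCompact_closedBall 0 r)).subset fun z hz => ?_
  have hzU : z ∈ Metric.closedBall (0 : ℂ) r := by simpa using hz.1
  rw [Function.mem_support, hf.divisor_eq_analyticOrderNatAt h0 hzU]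
  intro h
  have hn : analyticOrderNatAt f z = 0 := by exact_mod_cast h
  rw [analyticOrderNatAt, ENat.toNat_eq_zero] at hn
  rcases hn with hn | hn
  · exact (hf.analyticAt z).analyticOrderAt_ne_zero.2 hz.2 hn
  · exact hf.analyticOrderAt_ne_top h0 z hn

lemma Differentiable.zeroCount_le_finsum_divisor (hf : Differentiable ℂ f) {z₀ : ℂ}
    (h0 : f z₀ ≠ 0) {r R : ℝ} {c : ℂ}
    (hrR : Metric.closedBall (0 : ℂ) r ⊆ Metric.closedBall c R) :
    (zeroCount f r : ℤ) ≤ ∑ᶠ z, MeromorphicOn.divisor f (Metric.closedBall c R) z := by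
  set D := MeromorphicOn.divisor f (Metric.closedBall c R) with hD
  have hfin := D.finiteSupport (isCompact_closedBall c R)
  have hDz : ∀ z ∈ Metric.closedBall c R, D z = (analyticOrderNatAt f z : ℤ) := fun z hz =>
    hf.divisor_eq_analyticOrderNatAt h0 hz
  rw [finsum_eq_sum_of_support_subset (s := hfin.toFinset) _ (by simp), zeroCount, finsum_mem_def,
    finsum_eq_sum_of_support_subset (s := hfin.toFinset)]
  · push_cast
    refine Finset.sum_le_sum fun z hz => ?_
    by_cases hzr : z ∈ Metric.closedBall (0 : ℂ) r
    · rw [indicator_of_mem hzr, hDz z (hrR hzr)]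
    · rw [indicator_of_notMem hzr]
      by_cases hzR : z ∈ Metric.closedBall c R
      · rw [hDz z hzR]; positivity
      · rw [D.apply_eq_zero_of_notMem hzR]; simp
  · intro z hz
    rw [support_indicator] at hz
    simp only [Finite.coe_toFinset, Function.mem_support]
    rw [hDz z (hrR hz.1)]
    exact_mod_cast hz.2

/-- Jensen's inequality, centred at a point where `f` does not vanish. -/
lemma Differentiable.zeroCount_isBigO (hf : Differentiable ℂ f) {z₀ : ℂ} (h0 : f z₀ ≠ 0) {A c : ℝ}
    (hc : 0 < c) (hgr : ∀ z, ‖f z‖ ≤ A * Real.exp (c * √‖z‖)) :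
    (fun r : ℝ => (zeroCount f r : ℝ)) =O[atTop] fun r : ℝ => r ^ (1 / 2 : ℝ) := by
  -- `sum_divisor_le` requires a bound of at least `1` on the larger circle.
  set A' := max A 1
  have hA' : 1 ≤ A' := le_max_right _ _
  have hlog2 : 0 < Real.log 2 := Real.log_pos (by norm_num)
  refine Asymptotics.IsBigO.of_bound ((|Real.log A' - Real.log ‖f z₀‖| + c * √5) / Real.log 2) ?_
  filter_upwards [eventually_ge_atTop (‖z₀‖ + 1)] with r hr
  have hr1 : 1 ≤ r := by linarith [norm_nonneg z₀]
  have hr0 : 0 < r := by linarith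
  have hs1 : 1 ≤ √r := Real.one_le_sqrt.2 hr1
  have e1 : |2 * r| = 2 * r := abs_of_pos (by linarith)
  have e2 : |4 * r| = 4 * r := abs_of_pos (by linarith)
  set M := A' * Real.exp (c * √(5 * r)) with hM
  have hexp : 1 ≤ Real.exp (c * √(5 * r)) := Real.one_le_exp (by positivity)
  have hM1 : 1 ≤ M := by nlinarith
  have key := AnalyticOnNhd.sum_divisor_le (c := z₀) (r := 2 * r) (R := 4 * r) (M := M) (f := f)
    (by rw [e1]; linarith) (by rw [e1, e2]; linarith) hM1 (fun z _ => hf.analyticAt z) h0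
    (fun z hz => by
      rw [e2, mem_sphere_iff_norm] at hz
      have hz5 : ‖z‖ ≤ 5 * r := by linarith [norm_le_norm_add_norm_sub' z z₀]
      calc ‖f z‖ ≤ A * Real.exp (c * √‖z‖) := hgr z
        _ ≤ A' * Real.exp (c * √(5 * r)) := by gcongr; exact le_max_left _ _)
  -- The disk of radius `r` about `0` lies in the disk of radius `2 r` about `z₀`.
  have hcount := hf.zeroCount_le_finsum_divisor h0 (r := r) (R := |2 * r|) (c := z₀) (by
    rw [e1]
    refine Metric.closedBall_subset_closedBall' ?_
    rw [dist_zero_left]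
    linarith)
  have hcount' : (zeroCount f r : ℝ) ≤ Real.log (M / ‖f z₀‖) / Real.log (4 * r / (2 * r)) :=
    le_trans (by exact_mod_cast hcount) key
  have e3 : 4 * r / (2 * r) = 2 := by field_simp; norm_num
  have hA0 : A' ≠ 0 := by linarith
  rw [e3, Real.log_div (by linarith) (norm_ne_zero_iff.2 h0), hM,
    Real.log_mul hA0 (Real.exp_pos _).ne', Real.log_exp, Real.sqrt_mul (by norm_num)] at hcount'
  rw [Real.norm_of_nonneg (Nat.cast_nonneg _), Real.norm_of_nonneg (by positivity),
    ← Real.sqrt_eq_rpow]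
  refine hcount'.trans ?_
  rw [div_mul_eq_mul_div]
  gcongr
  nlinarith [le_abs_self (Real.log A' - Real.log ‖f z₀‖),
    abs_nonneg (Real.log A' - Real.log ‖f z₀‖)]

end ZeroCount

/-! ### The Wronskian as a function of the coupling constant -/

namespace IsSolutionFamily

variable {Q V : ℝ → ℝ} {u u₁ : ℂ → ℝ → ℂ}

/-- Lagrange's identity on `[0, 1]` for solutions at two real couplings. -/
lemma sub_mul_weighted_inner (h : IsSolutionFamily Q V u u₁) (s t : ℝ) :
    ((s : ℂ) - t) * ∫ x in (0 : ℝ)..1, (V x : ℂ) * (u s x * conj (u t x)) =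
      (u₁ s 1 * conj (u t 1) - u s 1 * conj (u₁ t 1)) -
        (u₁ 0 0 * conj (u 0 0) - u 0 0 * conj (u₁ 0 0)) := by
  have hstar := (h.isForcedSolution t).star.congr
    (q' := fun x => conj ((Q x : ℂ) + t * (V x : ℂ))) (f' := fun _ => 0) fun x => by simp
  have := (h.isForcedSolution s).wronskian_sub hstar 0 1
  rw [h.value_zero s, h.value_zero t, h.deriv_zero s, h.deriv_zero t] at this
  rw [← this, ← intervalIntegral.integral_const_mul]
  congr 1
  funext x
  simp only [map_add, map_mul, Complex.conj_ofReal]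
  ring

/-- Let `(a, a')` be nonzero Cauchy data at `1` carrying the same flux, the Wronskian with the
complex conjugate, as the common Cauchy data of the family at `0`. Then some member of the family
is not proportional to `(a, a')` at `1`. -/
theorem exists_wronskian_ne_zero (h : IsSolutionFamily Q V u u₁)
    (hne : ¬ (u 0 0 = 0 ∧ u₁ 0 0 = 0))
    (hV : ¬ ∀ᵐ x : ℝ, x ∈ Icc (0 : ℝ) 1 → V x = 0) {a a' : ℂ} (haa : ¬ (a = 0 ∧ a' = 0))
    (hW : a' * conj a - a * conj a' = u₁ 0 0 * conj (u 0 0) - u 0 0 * conj (u₁ 0 0)) :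
    ∃ z, a' * u z 1 - a * u₁ z 1 ≠ 0 := by
  by_contra hcon
  push Not at hcon
  obtain ⟨s, t, hst, hM⟩ := h.exists_weighted_inner_ne_zero hne hV
  have hst' : (s : ℂ) - t ≠ 0 := sub_ne_zero.2 fun e => hst (Complex.ofReal_injective e)
  have key := h.sub_mul_weighted_inner
  simp only [← hW] at key
  refine mul_ne_zero hst' hM ?_
  rw [key]
  rcases eq_or_ne a 0 with rfl | ha
  · have ha' : a' ≠ 0 := fun e => haa ⟨rfl, e⟩
    have hu : ∀ z, u z 1 = 0 := fun z => by simpa [ha'] using hcon z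
    simp [hu]
  · set μ : ℂ → ℂ := fun z => u z 1 / a with hμ
    have hu : ∀ z, u z 1 = μ z * a := fun z => (div_mul_cancel₀ _ ha).symm
    have hu₁ : ∀ z, u₁ z 1 = μ z * a' := fun z => by
      have := hcon z
      rw [hu z] at this
      have h2 : a * (u₁ z 1 - μ z * a') = 0 := by linear_combination -this
      exact sub_eq_zero.1 ((mul_eq_zero.1 h2).resolve_left ha)
    set W₀ := a' * conj a - a * conj a' with hW₀
    have hfac : ∀ s t : ℂ, u₁ s 1 * conj (u t 1) - u s 1 * conj (u₁ t 1) =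
        μ s * conj (μ t) * W₀ := fun s t => by
      rw [hu, hu, hu₁, hu₁, map_mul, map_mul, hW₀]; ring
    rw [hfac]
    rcases eq_or_ne W₀ 0 with h0 | h0
    · rw [h0]; ring
    · -- Conservation of the flux `W₀` makes `μ` unimodular on the real axis.
      have hnorm : ∀ x : ℝ, μ x * conj (μ x) = 1 := fun x => by
        have := key x x
        rw [hfac, sub_self, zero_mul] at this
        have h2 : (μ x * conj (μ x) - 1) * W₀ = 0 := by linear_combination -this
        exact sub_eq_zero.1 ((mul_eq_zero.1 h2).resolve_right h0)
      have hd : Differentiable ℂ μ :=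
        (h.differentiable_coupling (right_mem_Icc.2 zero_le_one)).1.div_const a
      obtain ⟨A, c, hA, hc, hgr⟩ := h.exists_growth
      have hconst := hd.apply_eq_apply_of_order_half (A := A / ‖a‖) (c := c) (B := 1)
        (fun z => by
          rw [hμ, norm_div, div_mul_eq_mul_div]
          have := (hgr z 1 (right_mem_Icc.2 zero_le_one)).1
          gcongr)
        (fun x => by
          have := hnorm x
          rw [Complex.mul_conj'] at this
          have h2 : ‖μ x‖ ^ 2 = 1 := by exact_mod_cast this
          nlinarith [norm_nonneg (μ x)])
      rw [hconst s t, hnorm]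
      ring

end IsSolutionFamily

/-- Solutions agreeing on the open left half-line have the same Cauchy data at `0`, even when they
solve different equations. -/
lemma IsSchrodingerSolution.cauchyData_eq {q q' u v : ℝ → ℂ} (hu : IsSchrodingerSolution q u)
    (hv : IsSchrodingerSolution q' v) (h : ∀ x < 0, u x = v x) :
    u 0 = v 0 ∧ deriv u 0 = deriv v 0 := by
  have hmem : (0 : ℝ) ∈ closure (Iio 0) := by simp
  have h1 : EqOn u v (Iio 0) := h
  have h2 : EqOn (deriv u) (deriv v) (Iio 0) := fun x hx => by
    refine Filter.EventuallyEq.deriv_eq ?_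
    filter_upwards [Iio_mem_nhds hx] with y hy using h y hy
  exact ⟨h1.closure hu.isForcedSolution.continuous hv.isForcedSolution.continuous hmem,
    h2.closure hu.isForcedSolution.continuous_deriv hv.isForcedSolution.continuous_deriv hmem⟩

theorem theorem2 (Q V : ℝ → ℝ) (hQ : LocallyIntegrable Q volume)
    (hV : Integrable V volume) (hsupp : ∀ᵐ x : ℝ, x ∉ Set.Icc (0 : ℝ) 1 → V x = 0)
    (hV0 : ¬ (∀ᵐ x : ℝ, V x = 0))
    (u₀ : ℝ → ℂ) (hu₀ : IsSchrodingerSolution (fun x => (Q x : ℂ)) u₀)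
    (hu₀_ne : ∃ x : ℝ, u₀ x ≠ 0)
    (u : ℂ → ℝ → ℂ)
    (hu : ∀ z : ℂ, IsSchrodingerSolution (fun x => (Q x : ℂ) + z * (V x : ℂ)) (u z))
    (hu_left : ∀ z : ℂ, ∀ x : ℝ, x < 0 → u z x = u₀ x) :
    ∃ b : ℂ → ℂ,
      (∀ z : ℂ, ∀ x : ℝ, 1 < x → schrodingerWronskian u₀ (u z) x = b z) ∧
      Differentiable ℂ b ∧
      (∃ z : ℂ, b z ≠ 0) ∧
      (∃ C c : ℝ, 0 < C ∧ 0 < c ∧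
        ∀ z : ℂ, ‖b z‖ ≤ C * Real.exp (c * ‖z‖ ^ (1 / 2 : ℝ))) ∧
      (∀ r : ℝ, {z : ℂ | ‖z‖ ≤ r ∧ b z = 0}.Finite) ∧
      Asymptotics.IsBigO Filter.atTop (fun r : ℝ => (zeroCount b r : ℝ))
        (fun r : ℝ => r ^ (1 / 2 : ℝ)) := by
  have h₀ := hu₀.isForcedSolution
  have hQc := locallyIntegrable_ofReal hQ
  have hcauchy : ∀ z, u z 0 = u₀ 0 ∧ deriv (u z) 0 = deriv u₀ 0 := fun z =>
    (hu z).cauchyData_eq hu₀ (hu_left z)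
  have h : IsSolutionFamily Q V u (fun z => deriv (u z)) :=
    { locallyIntegrable_Q := hQ
      locallyIntegrable_V := hV.locallyIntegrable
      isForcedSolution := fun z => (hu z).isForcedSolution
      value_zero := fun z => (hcauchy z).1.trans (hcauchy 0).1.symm
      deriv_zero := fun z => (hcauchy z).2.trans (hcauchy 0).2.symm }
  have hdata : ∀ x, ¬ (u₀ x = 0 ∧ deriv u₀ x = 0) := fun x hx =>
    hu₀_ne.elim fun y hy => hy (h₀.eq_zero hQc hx.1 hx.2 y).1
  have h1 : (1 : ℝ) ∈ Icc (0 : ℝ) 1 := right_mem_Icc.2 zero_le_one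
  set b : ℂ → ℂ := fun z => deriv u₀ 1 * u z 1 - u₀ 1 * deriv (u z) 1 with hb
  have hd : Differentiable ℂ b :=
    ((h.differentiable_coupling h1).1.const_mul _).sub
      ((h.differentiable_coupling h1).2.const_mul _)
  have hbne : ∃ z, b z ≠ 0 := by
    refine h.exists_wronskian_ne_zero ?_ ?_ (hdata 1) ?_
    · rw [(hcauchy 0).1, (hcauchy 0).2]; exact hdata 0
    · intro hIcc
      refine hV0 ?_
      filter_upwards [hsupp, hIcc] with x hx1 hx2
      by_cases hx : x ∈ Icc (0 : ℝ) 1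
      exacts [hx2 hx, hx1 hx]
    · rw [(hcauchy 0).1, (hcauchy 0).2]
      have := h₀.wronskian_sub (h₀.star.congr (q' := fun x => (Q x : ℂ)) (f' := fun _ => 0)
        fun x => by simp) 0 1
      simp only [sub_self, zero_mul, intervalIntegral.integral_zero] at this
      exact (sub_eq_zero.1 this.symm)
  obtain ⟨A, c, hA, hc, hgr⟩ := h.exists_growth
  set B := ‖deriv u₀ 1‖ + ‖u₀ 1‖ + 1 with hB
  have hbgr : ∀ z, ‖b z‖ ≤ B * A * Real.exp (c * √‖z‖) := fun z => by
    obtain ⟨g1, g2⟩ := hgr z 1 h1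
    calc ‖b z‖ ≤ ‖deriv u₀ 1‖ * ‖u z 1‖ + ‖u₀ 1‖ * ‖deriv (u z) 1‖ := by
          refine (norm_sub_le _ _).trans ?_
          rw [norm_mul, norm_mul]
      _ ≤ ‖deriv u₀ 1‖ * (A * Real.exp (c * √‖z‖)) + ‖u₀ 1‖ * (A * Real.exp (c * √‖z‖)) := by
          gcongr
      _ ≤ B * A * Real.exp (c * √‖z‖) := by
          have : 0 < A * Real.exp (c * √‖z‖) := by positivity
          rw [hB]; linarith
  obtain ⟨z₀, hz₀⟩ := hbne
  refine ⟨b, fun z x hx => ?_, hd, ⟨z₀, hz₀⟩, ⟨B * A, c, by positivity, hc, fun z => ?_⟩,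
    hd.finite_zeros_norm_le hz₀, hd.zeroCount_isBigO hz₀ hc hbgr⟩
  · have := h₀.wronskian_sub (h.isForcedSolution z) 1 x
    rw [intervalIntegral.integral_congr_ae (g := fun _ => 0), intervalIntegral.integral_zero]
      at this
    · exact sub_eq_zero.1 this.symm
    · filter_upwards [hsupp] with y hy hyx
      rw [uIoc_of_le hx.le] at hyx
      rw [hy fun hy' => absurd hy'.2 (not_le.2 hyx.1)]
      simp
  · rw [← Real.sqrt_eq_rpow]; exact hbgr z
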